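/- All logarithms are to base $2$. A family $\{h_s\}_{s\in\{0,1\}^d}$ of functions $\{0,1\}^n\to\{0,1\}^m$ is \emph{$q$-universal} if, for a uniformly random seed $s$, each $h_s(x)$ is uniform on $\{0,1\}^m$, and $h_s(x_1),\dots,h_s(x_q)$ are independent for all distinct $x_1,\dots,x_q$. A distribution has $k$ bits of min-entropy (is a $k$-source) if all its point probabilities are at most $2^{-k}$; a flat $k$-source is uniform on a set of $2^k$ strings. The family \emph{condenses} $X$ with loss $\ell$ and error $\epsilon$ if, for a uniform seed $S$ independent of $X$, the pair $(S,h_S(X))$ has statistical distance at most $\epsilon$ from some pair $(S,Y)$ such that for every $s$ the distribution of $Y$ given $S=s$ has $m-\ell$ bits of min-entropy. It is a \emph{$(k,\ell,\epsilon)$-condenser} if it condenses every $k$-source on $\{0,1\}^n$ with loss $\ell$ and error $\epsilon$. Write $\rho(x)=\frac{\log\log x}{\log x}$. \textbf{Theorem (Impossibilities for $q$-universal condensers).} (1) For every constant $C$ there are $C'>0$ and $q_0$ such that for all integers $q\ge q_0$, all $n\ge m=k$ with $k>2\log q$ and all $d$, no $q$-universal family from $n$ to $m$ bits with $d$-bit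 seeds is a $(k,\ell,\epsilon)$-condenser when $$\ell\le \log q-\log\log q-\log(2\mathrm e)+C\rho(q),\qquad \epsilon\le 2^{-q(1+C'\rho(q))}.$$ (2) For every constant $C$ there are $K,c,\epsilon_0>0$ such that the following holds for all $0<\epsilon<\epsilon_0$, with $L=\log(1/\epsilon)$, all $n\ge m=k$ with $m>2\log L$, and all $\ell\le\log L-\log\log L-\log(2\mathrm e)+C\rho(L)$. (a) If $(1-c)L\le q\le L-K\,L\,\rho(L)$, then no $q$-universal family from $n$ to $m$ bits is a $(k,\ell,\epsilon)$-condenser. (b) For every integer $q$ with $0\le q\le L-K\,L\,\rho(L)$, not every $q$-universal family from $n$ to $m$ bits is a $(k,\ell,\epsilon)$-condenser. That is, independence $q=(1-o(1))\log(1/\epsilon)$ is necessary for $q$-universality to guarantee a condenser. These facts hold even for all flat $k$-sources: in (1) and (2a) the family condenses no flat $k$-source with loss $\ell$ and error $\epsilon$, and in (2b) there is a $q$-universal family that condenses no flat $k$-source with this loss and error. -/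

import Mathlib

namespace Condensers

/-- Bit strings of length `n`. -/
abbrev BitStr (n : ℕ) : Type := Fin n → Bool

/-- The probability of an event over a uniformly random `d`-bit seed. -/
noncomputable def seedProb {d : ℕ} (P : BitStr d → Prop) [DecidablePred P] : ℝ :=
  ((Finset.univ.filter P).card : ℝ) / 2 ^ d

/-- `q`-universal (`q`-wise independent) hash family from `n` to `m` bits with `d`-bit seeds: for a
uniformly random seed every hash value is uniformly distributed, and the hash values of any `q`
distinct inputs are independent. -/
def IsUniversal {n m d : ℕ} (q : ℕ) (h : BitStr d → BitStr n → BitStr m) : Prop :=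
  (∀ (x : BitStr n) (y : BitStr m), seedProb (fun s => h s x = y) = 1 / 2 ^ m) ∧
  ∀ x : Fin q → BitStr n, Function.Injective x → ∀ y : Fin q → BitStr m,
    seedProb (fun s => ∀ i, h s (x i) = y i) = ∏ i, seedProb (fun s => h s (x i) = y i)

/-- The distribution `p` has (at least) `k` bits of min-entropy. -/
def HasMinEntropy {α : Type} (p : PMF α) (k : ℝ) : Prop :=
  ∀ x, (p x).toReal ≤ (2 : ℝ) ^ (-k)

/-- A flat `k`-source on `n`-bit strings: uniform on a set of exactly `2 ^ k` strings. -/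
def IsFlatSource {n : ℕ} (X : PMF (BitStr n)) (k : ℕ) : Prop :=
  ∃ (A : Finset (BitStr n)) (hA : A.Nonempty), A.card = 2 ^ k ∧ X = PMF.uniformOfFinset A hA

/-- Statistical distance of two distributions on a finite set. -/
noncomputable def statDist {α : Type} [Fintype α] (p p' : PMF α) : ℝ :=
  (1 / 2) * ∑ x, |(p x).toReal - (p' x).toReal|

/-- The joint distribution of `(S, Y)`, where the seed `S` is uniform on `d`-bit strings and `Y`
has the distribution `Y s` conditioned on `S = s`. -/
noncomputable def withSeed {d m : ℕ} (Y : BitStr d → PMF (BitStr m)) :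
    PMF (BitStr d × BitStr m) :=
  (PMF.uniformOfFintype (BitStr d)).bind fun s => (Y s).map fun y => (s, y)

/-- `h` condenses the source `X` with loss `ℓ` and error `ε`: for a uniform seed `S` independent of
`X`, the pair `(S, h_S(X))` is `ε`-close to a pair `(S, Y)` such that, for every seed `s`, the
distribution of `Y` given `S = s` has `m - ℓ` bits of min-entropy. -/
def Condenses {n m d : ℕ} (h : BitStr d → BitStr n → BitStr m) (X : PMF (BitStr n))
    (ℓ ε : ℝ) : Prop :=
  ∃ Y : BitStr d → PMF (BitStr m), (∀ s, HasMinEntropy (Y s) ((m : ℝ) - ℓ)) ∧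
    statDist (withSeed fun s => X.map (h s)) (withSeed Y) ≤ ε

/-- `(k, ℓ, ε)`-condensers: all `k`-sources are condensed with loss `ℓ` and error `ε`. -/
def IsCondenser {n m d : ℕ} (h : BitStr d → BitStr n → BitStr m) (k ℓ ε : ℝ) : Prop :=
  ∀ X : PMF (BitStr n), HasMinEntropy X k → Condenses h X ℓ ε

/-- `log log x / log x`, with logarithms to base `2`. -/
noncomputable def rho (x : ℝ) : ℝ := Real.logb 2 (Real.logb 2 x) / Real.logb 2 x

/-- `log x - log log x - log (2 e)`, with logarithms to base `2`. -/
noncomputable def lossTerm (x : ℝ) : ℝ :=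
  Real.logb 2 x - Real.logb 2 (Real.logb 2 x) - Real.logb 2 (2 * Real.exp 1)

end Condensers

namespace Condensers

/-! Throw a flat source's `2 ^ m` balls into `2 ^ m` bins. Under `(r + 1)`-wise independence a fixed
bin gets at least `r` balls with probability at least `(r + 1) ^ (-(r + 1))`: a polynomial of degree
`r + 1` below the indicator of `r ≤ z` has the same mean as under full independence
(`IsUniversal.card_load_ge`). If `r ≥ 2 ^ ℓ + 1`, such a bin exceeds the permitted mass by at least
`2 ^ (-m)`; summing over bins, the error is at least that probability (`IsUniversal.not_condenses`).
With `x = q` or `x = L`, the allowed loss gives `2 ^ ℓ ≤ x / (2 log x)`, so a suitable `r` has `(r +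
1) log (r + 1) < x`, and error `2 ^ (-x)` is impossible (`eventually_exists_load`). -/

open Finset

/-! ### Factorial moments of bin loads -/

/-- The seeds of a `q`-universal family that prescribe given values on a set of at most `q` inputs
have the density they would have for independent uniform hash values. -/
theorem IsUniversal.card_filter_eq {n m d q : ℕ} {h : BitStr d → BitStr n → BitStr m}
    (hh : IsUniversal q h) (hq : q ≤ 2 ^ n) (S : Finset (BitStr n)) (hS : #S ≤ q)
    (g : BitStr n → BitStr m) :
    #{s : BitStr d | ∀ x ∈ S, h s x = g x} * (2 ^ m) ^ #S = 2 ^ d := by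
  have full : ∀ T : Finset (BitStr n), #T = q → ∀ g : BitStr n → BitStr m,
      #{s : BitStr d | ∀ x ∈ T, h s x = g x} * (2 ^ m) ^ #T = 2 ^ d := by
    intro T hT g
    let e := T.equivFinOfCardEq hT
    have key := hh.2 (fun i => (e.symm i : BitStr n))
      (Subtype.val_injective.comp e.symm.injective) (fun i => g (e.symm i))
    simp only [hh.1, prod_const, card_univ, Fintype.card_fin] at key
    have hset : (univ.filter fun s : BitStr d => ∀ i, h s (e.symm i) = g (e.symm i)) =
        univ.filter fun s => ∀ x ∈ T, h s x = g x := by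
      ext s
      simp only [mem_filter, mem_univ, true_and]
      constructor
      · intro H x hx
        simpa using H (e ⟨x, hx⟩)
      · intro H i
        exact H _ (e.symm i).2
    rw [seedProb, hset, div_eq_iff (by positivity), one_div, inv_pow, inv_mul_eq_div,
      eq_div_iff (by positivity)] at key
    rw [hT]
    exact_mod_cast key
  -- Universality speaks of exactly `q` inputs. Surplus inputs are removed one at a time by summing
  -- over the `2 ^ m` values at the removed input.
  have descend : ∀ U : Finset (BitStr n), Disjoint S U →
      (∀ g : BitStr n → BitStr m,
        #{s : BitStr d | ∀ x ∈ S ∪ U, h s x = g x} * (2 ^ m) ^ #(S ∪ U) = 2 ^ d) →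
      ∀ g : BitStr n → BitStr m,
        #{s : BitStr d | ∀ x ∈ S, h s x = g x} * (2 ^ m) ^ #S = 2 ^ d := by
    intro U
    induction U using Finset.induction with
    | empty => intro _ H; simpa using H
    | insert a U ha ih =>
      intro hdis H
      rw [disjoint_insert_right] at hdis
      refine ih hdis.2 fun g => ?_
      have haS : a ∉ S ∪ U := by simp [ha, hdis.1]
      have hfib : #{s : BitStr d | ∀ x ∈ S ∪ U, h s x = g x} =
          ∑ v : BitStr m,
            #{s : BitStr d | ∀ x ∈ S ∪ insert a U, h s x = Function.update g a v x} := by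
        rw [card_eq_sum_card_fiberwise (f := fun s => h s a) (t := univ) (by simp)]
        refine sum_congr rfl fun v _ => congrArg card ?_
        ext s
        simp only [mem_filter, mem_univ, true_and, union_insert, forall_mem_insert,
          Function.update_self]
        rw [and_comm]
        refine and_congr_right fun _ => forall₂_congr fun x hx => ?_
        rw [Function.update_of_ne (ne_of_mem_of_not_mem hx haS)]
      have hc : #(S ∪ insert a U) = #(S ∪ U) + 1 := by
        rw [union_insert, card_insert_of_notMem haS]
      have hpow : (0 : ℕ) < (2 ^ m) := by positivity
      refine Nat.eq_of_mul_eq_mul_right hpow ?_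
      calc _ = ∑ v : BitStr m,
            #{s : BitStr d | ∀ x ∈ S ∪ insert a U, h s x = Function.update g a v x} *
              (2 ^ m) ^ #(S ∪ insert a U) := by
            rw [← sum_mul, ← hfib, hc, pow_succ, mul_assoc]
        _ = _ := by rw [sum_congr rfl fun v _ => H _]; simp [mul_comm]
  obtain ⟨T, hST, hT⟩ := exists_superset_card_eq hS (by simpa using hq)
  refine descend (T \ S) disjoint_sdiff ?_ g
  rw [union_sdiff_of_subset hST]
  exact full T hT

/-- The number of elements of `A` that `h s` sends to `y`. -/
def load {n m d : ℕ} (h : BitStr d → BitStr n → BitStr m) (A : Finset (BitStr n))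
    (y : BitStr m) (s : BitStr d) : ℕ :=
  #{x ∈ A | h s x = y}

/-- Double counting of pairs of a seed and an `i`-subset of `A` that it sends entirely to `y`. -/
theorem IsUniversal.sum_choose_load {n m d q : ℕ} {h : BitStr d → BitStr n → BitStr m}
    (hh : IsUniversal q h) (hq : q ≤ 2 ^ n) (A : Finset (BitStr n)) (y : BitStr m) {i : ℕ}
    (hi : i ≤ q) :
    (∑ s, ((load h A y s).choose i : ℝ)) = (#A).choose i / (2 ^ m) ^ i * 2 ^ d := by
  have h1 : (∑ s, (load h A y s).choose i) =
      ∑ S ∈ A.powersetCard i, #{s : BitStr d | ∀ x ∈ S, h s x = y} := by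
    simp only [card_filter]
    rw [sum_comm]
    refine sum_congr rfl fun s _ => ?_
    rw [load, ← card_powersetCard, ← card_filter]
    refine congrArg card ?_
    ext S
    simp only [mem_powersetCard, mem_filter, subset_iff]
    grind
  have h2 : (∑ s, (load h A y s).choose i) * (2 ^ m) ^ i = (#A).choose i * 2 ^ d := by
    rw [h1, sum_mul, ← card_powersetCard, ← smul_eq_mul, ← sum_const]
    refine sum_congr rfl fun S hS => ?_
    have hc := (mem_powersetCard.1 hS).2
    have := hh.card_filter_eq hq S (hc.le.trans hi) fun _ => y
    rwa [hc] at this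
  rw [div_mul_eq_mul_div, eq_div_iff (by positivity)]
  exact_mod_cast h2

/-! ### Heavy bins -/

/-- A polynomial of degree `r + 1` below the indicator function of `r ≤ z`. -/
theorem choose_sub_mul_choose_succ_le {r : ℕ} (hr : 1 ≤ r) (z : ℕ) :
    (z.choose r : ℝ) - r * z.choose (r + 1) ≤ if r ≤ z then 1 else 0 := by
  split_ifs with hz
  · obtain ⟨j, rfl⟩ := Nat.exists_eq_add_of_le hz
    have hs : ((r + j).choose (r + 1) : ℝ) * (r + 1) = (r + j).choose r * j := by
      have := Nat.choose_succ_right_eq (r + j) r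
      rw [Nat.add_sub_cancel_left] at this
      exact_mod_cast this
    -- The polynomial equals 1 at `z = r` and `z = r + 1`, and is nonpositive from `z = r + 2` on.
    rcases j with _ | _ | j
    · simp
    · rw [zero_add, Nat.choose_self, Nat.choose_succ_self_right]; push_cast; linarith
    · have hr' : (1 : ℝ) ≤ r := by exact_mod_cast hr
      have hle : ((r + (j + 1 + 1)).choose r : ℝ) ≤
          r * (r + (j + 1 + 1)).choose (r + 1) := by
        refine le_of_mul_le_mul_right (a := (r : ℝ) + 1) ?_ (by positivity)
        rw [mul_assoc, hs]
        push_cast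
        have : (r : ℝ) + 1 ≤ r * (j + 1 + 1) := by nlinarith [(Nat.cast_nonneg j : (0 : ℝ) ≤ j)]
        calc _ ≤ ((r + (j + 1 + 1)).choose r : ℝ) * (r * (j + 1 + 1)) := by gcongr
          _ = _ := by ring
      linarith
  · rw [Nat.choose_eq_zero_of_lt (by omega), Nat.choose_eq_zero_of_lt (by omega)]; simp

/-- Factor by factor, `N (r - i) ≤ (N - i) r` for `i < r`. -/
theorem pow_le_choose_mul_pow {N r : ℕ} (hr : r ≤ N) : N ^ r ≤ N.choose r * r ^ r := by
  have h : N ^ r * r.factorial ≤ N.choose r * r ^ r * r.factorial := by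
    rw [mul_right_comm, mul_comm (N.choose r), ← Nat.descFactorial_eq_factorial_mul_choose,
      ← Nat.descFactorial_self r, Nat.descFactorial_eq_prod_range, Nat.descFactorial_eq_prod_range,
      pow_eq_prod_const, pow_eq_prod_const, ← prod_mul_distrib, ← prod_mul_distrib]
    refine prod_le_prod' fun i hi => ?_
    have hi := mem_range.1 hi
    zify [hi.le, (hi.le.trans hr)]
    nlinarith
  exact Nat.le_of_mul_le_mul_right h r.factorial_pos

/-- With `2 ^ m` balls and `2 ^ m` bins, a bin holds `r` balls with noticeable probability. -/
theorem IsUniversal.card_load_ge {n m d q : ℕ} {h : BitStr d → BitStr n → BitStr m}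
    (hh : IsUniversal q h) (hq : q ≤ 2 ^ n) {A : Finset (BitStr n)} (hA : #A = 2 ^ m)
    (y : BitStr m) {r : ℕ} (hr : 1 ≤ r) (hrq : r + 1 ≤ q) (hrm : r ≤ 2 ^ m) :
    (2 : ℝ) ^ d / ((r : ℝ) + 1) ^ (r + 1) ≤ #{s : BitStr d | r ≤ load h A y s} := by
  have hsum : (∑ s, (((load h A y s).choose r : ℝ) - r * (load h A y s).choose (r + 1))) ≤
      #{s : BitStr d | r ≤ load h A y s} := by
    rw [card_filter]
    push_cast
    exact sum_le_sum fun s _ => choose_sub_mul_choose_succ_le hr _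
  refine le_trans ?_ hsum
  rw [sum_sub_distrib, ← mul_sum, hh.sum_choose_load hq A y (by omega),
    hh.sum_choose_load hq A y hrq, hA]
  have hr0 : (0 : ℝ) < r := by exact_mod_cast hr
  have hs : ((2 ^ m).choose (r + 1) : ℝ) = (2 ^ m).choose r * ((2 : ℝ) ^ m - r) / (r + 1) := by
    rw [eq_div_iff (by positivity)]
    have := Nat.choose_succ_right_eq (2 ^ m) r
    have h2 : (((2 ^ m - r : ℕ)) : ℝ) = (2 : ℝ) ^ m - r := by rw [Nat.cast_sub hrm]; simp
    rw [← h2]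
    exact_mod_cast this
  have hc : ((2 : ℝ) ^ m) ^ r ≤ (2 ^ m).choose r * (r : ℝ) ^ r := by
    exact_mod_cast pow_le_choose_mul_pow hrm
  have hN : (0 : ℝ) < 2 ^ m := by positivity
  generalize ((2 ^ m).choose r : ℝ) = c at *
  generalize (2 : ℝ) ^ m = N at *
  have hc0 : 0 < c := pos_of_mul_pos_left (lt_of_lt_of_le (by positivity) hc) (by positivity)
  -- The last factor is at least `1 / (r + 1)`, so subtracting the second moment costs at most a
  -- factor `r + 1`.
  have e : c / N ^ r * 2 ^ d - r * (((2 ^ m).choose (r + 1) : ℝ) / N ^ (r + 1) * 2 ^ d) =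
      2 ^ d * (c / N ^ r * ((N + r ^ 2) / (N * (r + 1)))) := by
    rw [hs]; field_simp; ring
  rw [e, div_eq_mul_inv]
  gcongr
  calc (((r : ℝ) + 1) ^ (r + 1))⁻¹ ≤ ((r : ℝ) ^ r)⁻¹ * ((r : ℝ) + 1)⁻¹ := by
        rw [← mul_inv, pow_succ]
        gcongr
        linarith
    _ ≤ _ := by
        gcongr
        · rw [inv_eq_one_div, div_le_div_iff₀ (by positivity) (by positivity)]; linarith
        · rw [inv_eq_one_div, div_le_div_iff₀ (by positivity) (by positivity)]
          nlinarith [mul_nonneg (sq_nonneg (r : ℝ)) (by linarith : (0 : ℝ) ≤ r + 1)]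

/-! ### From heavy bins to statistical distance -/

theorem sum_toReal_eq_one {α : Type} [Fintype α] (p : PMF α) : ∑ a, (p a).toReal = 1 := by
  rw [← ENNReal.toReal_sum fun a _ => p.apply_ne_top a, ← tsum_fintype (L := .unconditional _),
    p.tsum_coe, ENNReal.toReal_one]

/-- The differences sum to zero, so their positive parts make up half of the `ℓ₁` norm. -/
theorem sum_posPart_le_statDist {α : Type} [Fintype α] (p p' : PMF α) :
    ∑ a, max ((p a).toReal - (p' a).toReal) 0 ≤ statDist p p' := by
  have h0 : ∑ a, ((p a).toReal - (p' a).toReal) = 0 := by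
    rw [sum_sub_distrib, sum_toReal_eq_one, sum_toReal_eq_one, sub_self]
  have h1 : ∀ u : ℝ, max u 0 = 1 / 2 * |u| + 1 / 2 * u := by
    intro u
    rcases le_total 0 u with h | h
    · rw [max_eq_left h, abs_of_nonneg h]; ring
    · rw [max_eq_right h, abs_of_nonpos h]; ring
  simp only [h1]
  rw [sum_add_distrib, ← mul_sum, ← mul_sum, h0, mul_zero, add_zero, statDist]

theorem withSeed_apply_toReal {d m : ℕ} (Y : BitStr d → PMF (BitStr m)) (s : BitStr d)
    (y : BitStr m) : (withSeed Y (s, y)).toReal = (Y s y).toReal / 2 ^ d := by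
  have hmap : ∀ t : BitStr d, ((Y t).map fun y => (t, y)) (s, y) = if t = s then Y s y else 0 := by
    intro t
    rw [PMF.map_apply, tsum_fintype]
    split_ifs with hts
    · subst hts
      simp
    · simp [Ne.symm hts]
  rw [withSeed, PMF.bind_apply, tsum_fintype]
  simp only [hmap, PMF.uniformOfFintype_apply]
  simp [div_eq_inv_mul]

theorem map_uniformOfFinset_toReal {n m d : ℕ} (h : BitStr d → BitStr n → BitStr m)
    (A : Finset (BitStr n)) (hA : A.Nonempty) (s : BitStr d) (y : BitStr m) :
    (((PMF.uniformOfFinset A hA).map (h s)) y).toReal = load h A y s / #A := by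
  have hterm : ∀ b, (if y = h s b then PMF.uniformOfFinset A hA b else 0) =
      if b ∈ A.filter fun x => h s x = y then ((#A : ENNReal))⁻¹ else 0 := by
    intro b
    rw [PMF.uniformOfFinset_apply]
    simp only [mem_filter]
    grind
  rw [PMF.map_apply, tsum_fintype]
  refine (congrArg ENNReal.toReal (sum_congr rfl fun b _ => by convert hterm b)).trans ?_
  rw [sum_ite_mem, univ_inter, sum_const, nsmul_eq_mul, ENNReal.toReal_mul, ENNReal.toReal_inv,
    ENNReal.toReal_natCast, ENNReal.toReal_natCast, div_eq_mul_inv, load]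

theorem IsFlatSource.hasMinEntropy {n k : ℕ} {X : PMF (BitStr n)} (hX : IsFlatSource X k) :
    HasMinEntropy X k := by
  obtain ⟨A, hA, hc, rfl⟩ := hX
  intro x
  rw [PMF.uniformOfFinset_apply, Real.rpow_neg two_pos.le, Real.rpow_natCast, hc]
  split_ifs <;> simp

theorem exists_isFlatSource {n k : ℕ} (h : k ≤ n) : ∃ X : PMF (BitStr n), IsFlatSource X k := by
  obtain ⟨A, -, hA⟩ := exists_subset_card_eq (s := (univ : Finset (BitStr n))) (n := 2 ^ k)
    (by simpa using Nat.pow_le_pow_right two_pos h)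
  have hne : A.Nonempty := card_pos.1 (by rw [hA]; positivity)
  exact ⟨_, A, hne, hA, rfl⟩

/-- If a bin holds `r` balls with noticeable probability, then loads are not bounded by
`2 ^ ℓ ≤ r - 1` up to a smaller error. -/
theorem IsUniversal.not_condenses {n m d q : ℕ} {h : BitStr d → BitStr n → BitStr m}
    (hh : IsUniversal q h) (hq : q ≤ 2 ^ n) {r : ℕ} (hrq : r + 1 ≤ q) (hrm : r ≤ 2 ^ m)
    {ℓ ε : ℝ} (hℓ : (2 : ℝ) ^ ℓ + 1 ≤ r) (hε : ε < (((r : ℝ) + 1) ^ (r + 1))⁻¹)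
    {X : PMF (BitStr n)} (hX : IsFlatSource X m) : ¬ Condenses h X ℓ ε := by
  rintro ⟨Y, hY, hdist⟩
  obtain ⟨A, hA, hc, rfl⟩ := hX
  have hr : 1 ≤ r := by
    have : (0 : ℝ) < 2 ^ ℓ := by positivity
    exact_mod_cast (by linarith : (1 : ℝ) ≤ r)
  refine absurd (hdist.trans_lt hε) (not_lt.2 ?_)
  refine le_trans ?_ (sum_posPart_le_statDist _ _)
  have hpt : ∀ (s : BitStr d) (y : BitStr m),
      (if r ≤ load h A y s then (1 : ℝ) else 0) / 2 ^ m / 2 ^ d ≤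
      max (((withSeed fun s => (PMF.uniformOfFinset A hA).map (h s)) (s, y)).toReal -
        (withSeed Y (s, y)).toReal) 0 := by
    intro s y
    rw [withSeed_apply_toReal, withSeed_apply_toReal, map_uniformOfFinset_toReal, hc]
    split_ifs with hl
    · refine le_max_of_le_left ?_
      rw [← sub_div]
      gcongr
      have h1 := hY s y
      rw [neg_sub, Real.rpow_sub two_pos, Real.rpow_natCast] at h1
      have h2 : (r : ℝ) ≤ load h A y s := by exact_mod_cast hl
      push_cast
      refine le_trans ?_ (sub_le_sub_left h1 _)
      rw [← sub_div]
      gcongr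
      linarith
    · simp
  rw [Fintype.sum_prod_type_right]
  refine le_trans ?_ (sum_le_sum fun y _ => sum_le_sum fun s _ => hpt s y)
  simp only [← sum_div, ← natCast_card_filter]
  rw [le_div_iff₀ (by positivity), le_div_iff₀ (by positivity)]
  calc _ = ∑ _y : BitStr m, (2 : ℝ) ^ d / ((r : ℝ) + 1) ^ (r + 1) := by
        simp only [sum_const, card_univ, Fintype.card_fun, Fintype.card_bool, Fintype.card_fin,
          nsmul_eq_mul]
        push_cast
        ring
    _ ≤ _ := sum_le_sum fun y _ => hh.card_load_ge hq hc y hr hrq hrm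

/-! ### A family that is universal for every `q` -/

/-- For every `q` there is a `q`-universal family: the family of all functions. -/
theorem exists_isUniversal (n m : ℕ) : ∃ (d : ℕ) (h : BitStr d → BitStr n → BitStr m),
    ∀ q, IsUniversal q h := by
  -- The seed is the truth table of the function.
  let e : BitStr (2 ^ n * m) ≃ (BitStr n → BitStr m) :=
    (Equiv.arrowCongr (finProdFinEquiv.symm.trans (Equiv.prodCongr
      (Fintype.equivFinOfCardEq (by simp)).symm (Equiv.refl _))) (Equiv.refl Bool)).trans
        (Equiv.curry _ _ _)
  have count : ∀ (q : ℕ) (x : Fin q → BitStr n), Function.Injective x → ∀ y : Fin q → BitStr m,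
      seedProb (fun s => ∀ i, e s (x i) = y i) = (1 / 2 ^ m) ^ q := by
    intro q x hx y
    have hcard : #{s | ∀ i, e s (x i) = y i} * (2 ^ m) ^ q = 2 ^ (2 ^ n * m) := by
      have h1 : #{s | ∀ i, e s (x i) = y i} =
          #(Fintype.piFinset fun z : BitStr n => {v : BitStr m | ∀ i, x i = z → v = y i}) := by
        refine card_equiv e fun s => ?_
        simp only [mem_filter, mem_univ, true_and, Fintype.mem_piFinset]
        grind
      have h2 : ((2 : ℕ) ^ m) ^ q = ∏ z : BitStr n, if z ∈ univ.image x then 2 ^ m else 1 := by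
        rw [prod_ite_mem, univ_inter, prod_const, card_image_of_injective _ hx, card_fin]
      rw [h1, Fintype.card_piFinset, h2, ← prod_mul_distrib, prod_congr rfl
        (g := fun _ => 2 ^ m)]
      · simp [← pow_mul, mul_comm]
      · intro z _
        split_ifs with hz
        · obtain ⟨j, -, rfl⟩ := mem_image.1 hz
          have : ({v : BitStr m | ∀ i, x i = x j → v = y i} : Finset _) = {y j} := by
            ext v
            simp [hx.eq_iff]
          rw [this, card_singleton, one_mul]
        · have : ({v : BitStr m | ∀ i, x i = z → v = y i} : Finset _) = univ := by
            ext v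
            simp only [mem_filter, mem_univ, true_and, iff_true]
            intro i hi
            exact absurd (mem_image.2 ⟨i, mem_univ _, hi⟩) hz
          rw [this]
          simp
    rw [seedProb, div_eq_iff (by positivity), one_div, inv_pow, inv_mul_eq_div,
      eq_div_iff (by positivity)]
    exact_mod_cast hcard
  have single : ∀ (x : BitStr n) (y : BitStr m), seedProb (fun s => e s x = y) = 1 / 2 ^ m := by
    intro x y
    have := count 1 (fun _ => x) (Function.injective_of_subsingleton _) fun _ => y
    simpa using this
  refine ⟨_, e, fun q => ⟨single, fun x hx y => ?_⟩⟩
  rw [count q x hx y]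
  simp [single]

/-! ### Asymptotics of the parameters -/

theorem eventually_mul_logb_le (a : ℝ) (ha : 0 < a) :
    ∀ᶠ x : ℝ in Filter.atTop, a * Real.logb 2 x ≤ x := by
  have hlog2 : 0 < Real.log 2 := Real.log_pos one_lt_two
  have h := Real.isLittleO_log_id_atTop.bound (c := Real.log 2 / a) (by positivity)
  filter_upwards [h, Filter.eventually_ge_atTop 1] with x hx hx1
  rw [Real.norm_of_nonneg (Real.log_nonneg hx1), id, Real.norm_of_nonneg (by linarith)] at hx
  rw [Real.logb, mul_div_assoc', div_le_iff₀ hlog2]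
  rw [div_mul_eq_mul_div, le_div_iff₀ ha] at hx
  linarith

theorem eventually_mul_rho_le (C : ℝ) : ∀ᶠ x : ℝ in Filter.atTop, C * rho x ≤ 1 := by
  have h := (Real.tendsto_logb_atTop one_lt_two).eventually
    (eventually_mul_logb_le (|C| + 1) (by positivity))
  filter_upwards [h, (Real.tendsto_logb_atTop one_lt_two).eventually_ge_atTop 1]
    with x hx hx1
  have h0 : 0 ≤ Real.logb 2 (Real.logb 2 x) := Real.logb_nonneg one_lt_two hx1
  rw [rho, mul_div_assoc', div_le_one (by linarith)]
  nlinarith [le_abs_self C]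

/-- At loss `lossTerm x + C * rho x`, the load threshold `t` satisfies `t log t < x`. -/
theorem eventually_exists_load (C : ℝ) : ∀ᶠ x : ℝ in Filter.atTop,
    1 ≤ x ∧ 0 ≤ rho x ∧ ∀ ℓ ≤ lossTerm x + C * rho x, ∃ r : ℕ, (2 : ℝ) ^ ℓ + 1 ≤ r ∧
      (r : ℝ) + 1 ≤ x / 2 ∧ (2 : ℝ) ^ (-x) < (((r : ℝ) + 1) ^ (r + 1))⁻¹ := by
  filter_upwards [eventually_mul_rho_le C,
    (Real.tendsto_logb_atTop one_lt_two).eventually_ge_atTop 4,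
    eventually_mul_logb_le 7 (by norm_num), Filter.eventually_ge_atTop 8] with x hC hlog hx hx8
  have hx0 : 0 < x := by linarith
  refine ⟨by linarith, div_nonneg (Real.logb_nonneg one_lt_two (by linarith)) (by linarith),
    fun ℓ hℓ => ?_⟩
  -- Since `log (2e) ≥ 2` and `C * rho x ≤ 1`, one unit remains in the exponent: the factor 2 in the
  -- denominator.
  have hpow : (2 : ℝ) ^ ℓ ≤ x / (2 * Real.logb 2 x) := by
    have he : (2 : ℝ) ≤ Real.exp 1 := by linarith [Real.add_one_le_exp (1 : ℝ)]
    have h1 : (2 : ℝ) ≤ Real.logb 2 (2 * Real.exp 1) := by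
      rw [Real.le_logb_iff_rpow_le one_lt_two (by positivity)]
      norm_num
      linarith
    calc (2 : ℝ) ^ ℓ ≤ 2 ^ (Real.logb 2 x - Real.logb 2 (Real.logb 2 x) - 1) := by
          refine Real.rpow_le_rpow_of_exponent_le one_le_two ?_
          rw [lossTerm] at hℓ
          linarith
      _ = x / (2 * Real.logb 2 x) := by
          rw [Real.rpow_sub two_pos, Real.rpow_sub two_pos,
            Real.rpow_logb two_pos (by norm_num) hx0,
            Real.rpow_logb two_pos (by norm_num) (by linarith), Real.rpow_one, div_div, mul_comm 2]
  have hr := Nat.ceil_lt_add_one (Real.rpow_nonneg two_pos.le ℓ : (0 : ℝ) ≤ 2 ^ ℓ)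
  have hr' := Nat.le_ceil ((2 : ℝ) ^ ℓ)
  set r := ⌈(2 : ℝ) ^ ℓ⌉₊ + 1 with hrdef
  have hrc : (r : ℝ) = ⌈(2 : ℝ) ^ ℓ⌉₊ + 1 := by rw [hrdef]; push_cast; ring
  have hup : (r : ℝ) + 1 < x / (2 * Real.logb 2 x) + 3 := by linarith
  have h8 : x / (2 * Real.logb 2 x) ≤ x / 8 := by gcongr; linarith
  have hhalf : (r : ℝ) + 1 ≤ x / 2 := by linarith
  refine ⟨r, by linarith, hhalf, ?_⟩
  rw [Real.rpow_neg two_pos.le]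
  refine inv_strictAnti₀ (by positivity) ?_
  have hle : ((r : ℝ) + 1) ^ (r + 1) ≤ x ^ (r + 1) := by
    gcongr
    linarith
  refine hle.trans_lt ?_
  calc x ^ (r + 1) = (2 : ℝ) ^ (Real.logb 2 x * ((r + 1 : ℕ) : ℝ)) := by
        rw [Real.rpow_mul two_pos.le, Real.rpow_logb two_pos (by norm_num) hx0, Real.rpow_natCast]
    _ < 2 ^ x := by
        refine Real.rpow_lt_rpow_of_exponent_lt one_lt_two ?_
        push_cast
        -- The rounding overhead `3 log x` fits into `x / 2` because `7 log x ≤ x`.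
        calc _ < Real.logb 2 x * (x / (2 * Real.logb 2 x) + 3) := by gcongr
          _ = x / 2 + 3 * Real.logb 2 x := by field_simp
          _ ≤ x := by linarith

/-! ### Conclusion -/

/-- The failure of every family that is `q`-universal for a suitable `q` with `x / 2 ≤ q`. -/
theorem IsUniversal.not_isCondenser {n m d q : ℕ} {h : BitStr d → BitStr n → BitStr m}
    (hh : IsUniversal q h) (hmn : m ≤ n) {x : ℝ} (hx : 1 ≤ x) (hm : 2 * Real.logb 2 x < m)
    (hqx : x / 2 ≤ q) (hxq : (q : ℝ) ≤ x) {r : ℕ} {ℓ ε : ℝ} (hℓ : (2 : ℝ) ^ ℓ + 1 ≤ r)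
    (hr : (r : ℝ) + 1 ≤ x / 2) (hε : ε < (((r : ℝ) + 1) ^ (r + 1))⁻¹) :
    ¬ IsCondenser h m ℓ ε ∧ ∀ X : PMF (BitStr n), IsFlatSource X m → ¬ Condenses h X ℓ ε := by
  have hxm : x ≤ 2 ^ m := by
    have hlog : 0 ≤ Real.logb 2 x := Real.logb_nonneg one_lt_two hx
    rw [← Real.rpow_natCast, ← Real.logb_le_iff_le_rpow one_lt_two (by linarith)]
    linarith
  have hq : q ≤ 2 ^ n := by
    have : q ≤ 2 ^ m := by exact_mod_cast hxq.trans hxm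
    exact this.trans (Nat.pow_le_pow_right two_pos hmn)
  have hrq : r + 1 ≤ q := by exact_mod_cast hr.trans hqx
  have hrm : r ≤ 2 ^ m := by exact_mod_cast (by linarith : (r : ℝ) ≤ 2 ^ m)
  have flat : ∀ X : PMF (BitStr n), IsFlatSource X m → ¬ Condenses h X ℓ ε :=
    fun X hX => hh.not_condenses hq hrq hrm hℓ hε hX
  obtain ⟨X, hX⟩ := exists_isFlatSource hmn
  exact ⟨fun hc => flat X hX (hc X hX.hasMinEntropy), flat⟩

end Condensers

theorem mainTheorem1 :
    -- parameters in terms of `q`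
    (∀ C : ℝ, ∃ (C' : ℝ) (q₀ : ℕ), 0 < C' ∧ ∀ q : ℕ, q₀ ≤ q →
      ∀ n m d : ℕ, m ≤ n → 2 * Real.logb 2 (q : ℝ) < (m : ℝ) →
      ∀ h : Condensers.BitStr d → Condensers.BitStr n → Condensers.BitStr m,
        Condensers.IsUniversal q h →
      ∀ ℓ ε : ℝ, ℓ ≤ Condensers.lossTerm q + C * Condensers.rho q →
        ε ≤ (2 : ℝ) ^ (-((q : ℝ) * (1 + C' * Condensers.rho q))) →
        ¬ Condensers.IsCondenser h (m : ℝ) ℓ ε ∧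
        ∀ X : PMF (Condensers.BitStr n), Condensers.IsFlatSource X m →
          ¬ Condensers.Condenses h X ℓ ε) ∧
    -- parameters in terms of `L = log (1 / ε)`
    (∀ C : ℝ, ∃ K c ε₀ : ℝ, 0 < K ∧ 0 < c ∧ 0 < ε₀ ∧ ∀ ε L : ℝ, 0 < ε → ε < ε₀ →
      L = Real.logb 2 (1 / ε) →
      ∀ n m : ℕ, m ≤ n → 2 * Real.logb 2 L < (m : ℝ) →
      ∀ ℓ : ℝ, ℓ ≤ Condensers.lossTerm L + C * Condensers.rho L →
      ∀ q : ℕ, (q : ℝ) ≤ L - K * (L * Condensers.rho L) →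
        -- every `q`-universal family fails when `q` is close to `L`
        ((1 - c) * L ≤ (q : ℝ) →
          ∀ (d : ℕ) (h : Condensers.BitStr d → Condensers.BitStr n → Condensers.BitStr m),
            Condensers.IsUniversal q h →
            ¬ Condensers.IsCondenser h (m : ℝ) ℓ ε ∧
            ∀ X : PMF (Condensers.BitStr n), Condensers.IsFlatSource X m →
              ¬ Condensers.Condenses h X ℓ ε) ∧
        -- for all such `q`, being `q`-universal does not suffice
        (∃ (d : ℕ) (h : Condensers.BitStr d → Condensers.BitStr n → Condensers.BitStr m),
            Condensers.IsUniversal q h ∧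
            ¬ Condensers.IsCondenser h (m : ℝ) ℓ ε ∧
            ∀ X : PMF (Condensers.BitStr n), Condensers.IsFlatSource X m →
              ¬ Condensers.Condenses h X ℓ ε)) := by
  open Condensers in
  refine ⟨fun C => ?_, fun C => ?_⟩
  · obtain ⟨x₀, hx₀⟩ := Filter.eventually_atTop.1 (eventually_exists_load C)
    -- Any `C' > 0` would do: as `rho q ≥ 0`, only `ε ≤ 2 ^ (-q)` matters.
    refine ⟨1, ⌈x₀⌉₊, one_pos, fun q hq n m d hmn hm h hh ℓ ε hℓ hε => ?_⟩
    obtain ⟨hx1, hρ, hload⟩ := hx₀ q ((Nat.le_ceil x₀).trans (by exact_mod_cast hq))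
    obtain ⟨r, hr1, hr2, hr3⟩ := hload ℓ hℓ
    refine hh.not_isCondenser hmn hx1 hm (by linarith) le_rfl hr1 hr2 (lt_of_le_of_lt ?_ hr3)
    refine hε.trans (Real.rpow_le_rpow_of_exponent_le one_le_two ?_)
    nlinarith
  · obtain ⟨x₀, hx₀⟩ := Filter.eventually_atTop.1 (eventually_exists_load C)
    -- `K` only serves to give `q ≤ L`, and `c = 1 / 2` gives `L / 2 ≤ q`. The 2 in `ε₀` ensures `L
    -- / 2 ≤ ⌊L⌋₊` below.
    refine ⟨1, 1 / 2, 2 ^ (-(max x₀ 2)), one_pos, by norm_num, by positivity, ?_⟩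
    intro ε L hε hε₀ hL n m hmn hm ℓ hℓ q hq
    have hpow : (2 : ℝ) ^ (-L) = ε := by
      rw [hL, one_div, Real.logb_inv, neg_neg, Real.rpow_logb two_pos (by norm_num) hε]
    rw [← hpow, Real.rpow_lt_rpow_left_iff one_lt_two, neg_lt_neg_iff, max_lt_iff] at hε₀
    obtain ⟨hx1, hρ, hload⟩ := hx₀ L hε₀.1.le
    obtain ⟨r, hr1, hr2, hr3⟩ := hload ℓ hℓ
    rw [hpow] at hr3
    refine ⟨fun hqL d h hh => hh.not_isCondenser hmn hx1 hm (by linarith) (by nlinarith) hr1 hr2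
      hr3, ?_⟩
    -- For small `q` the witness is the family of all functions: it is `q`-universal, but its
    -- failure comes from its `⌊L⌋₊`-universality.
    obtain ⟨d, h, hh⟩ := exists_isUniversal n m
    refine ⟨d, h, hh q, (hh ⌊L⌋₊).not_isCondenser hmn hx1 hm ?_ (Nat.floor_le (by linarith))
      hr1 hr2 hr3⟩
    linarith [Nat.lt_floor_add_one L]
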